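/- Conventions. For a locally compact (Hausdorff) group $H$ with left Haar measure $dx$ (a regular Borel measure) and modular function $\Delta_H$, normalized by $\int_H f(xt)\,dx=\Delta_H(t)^{-1}\int_H f(x)\,dx$, let $\lambda_H$ and $\rho_H$ be the left and right regular representations on $\mathrm L^2(H)$, $$(\lambda_H(s)f)(x)=f(s^{-1}x),\qquad (\rho_H(t)f)(x)=\Delta_H(t)^{1/2}f(xt),$$ and let $\lambda_H\cdot\rho_H$ be the representation $(s,t)\mapsto\lambda_H(s)\rho_H(t)$ of $H\times H$ on $\mathrm L^2(H)$. For a topological group $\Gamma$, the Fell topology on the strongly continuous unitary representations of $\Gamma$ is generated by the sets $W(\pi;\xi;Q;\varepsilon)$, where $\pi$ is a representation on a Hilbert space $\mathcal H_\pi$, $\xi\in\mathcal H_\pi$, $Q\subseteq\Gamma$ is compact and $\varepsilon>0$; this set consists of all representations $\sigma$ for which there are finitely many vectors $\eta_1,\dots,\eta_m\in\mathcal H_\sigma$ with $$\Bigl|\langle\pi(x)\xi,\xi\rangle-\sum_{k=1}^m\langle\sigma(x)\eta_k,\eta_k\rangle\Bigr|<\varepsilon\qquad\text{for all }x\in Q.$$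 Theorem. Let $G$ be a locally compact group and let $\{N_\alpha\}_{\alpha\in A}$ be a family of closed normal subgroups of $G$, indexed by a directed set $A$, such that for every compact subset $K$ of $G$ and every neighbourhood $U$ of the identity in $G$ there exists an index $\alpha_0$ with $N_\alpha\cap K\subseteq U$ for every $\alpha\geq\alpha_0$. Fix left Haar measures on $G$ and on every quotient $G/N_\alpha$. For each $\alpha$, let $\sigma_\alpha$ be the representation of $G\times G$ on $\mathrm L^2(G/N_\alpha)$ defined by $$\sigma_\alpha(s,t)=\lambda_{G/N_\alpha}(\dot s)\,\rho_{G/N_\alpha}(\dot t),$$ where $\dot x$ denotes the coset $xN_\alpha$. Then the net $(\sigma_\alpha)$ converges to $\lambda_G\cdot\rho_G$ in the Fell topology. -/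

import Mathlib

open MeasureTheory MeasureTheory.Measure Filter Topology
open scoped NNReal ENNReal

noncomputable section

/-! ### Continuous unitary representations and the Fell topology -/

section Representations

universe u v

/-- A unitary representation of the topological group `Γ` on a complex Hilbert space (in the
universe `u`), continuous in the strong operator topology. -/
structure UnitaryRep (Γ : Type v) [Group Γ] [TopologicalSpace Γ] where
  /-- The Hilbert space on which the group acts. -/
  space : Type u
  [normed : NormedAddCommGroup space]
  [inner : InnerProductSpace ℂ space]
  [complete : CompleteSpace space]
  /-- The homomorphism into the group of unitary operators. -/
  toHom : Γ →* (space ≃ₗᵢ[ℂ] space)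
  continuous_apply : ∀ ξ : space, Continuous fun s => toHom s ξ

attribute [instance] UnitaryRep.normed UnitaryRep.inner UnitaryRep.complete

namespace UnitaryRep

variable {Γ : Type v} [Group Γ] [TopologicalSpace Γ]

/-- The coefficient function `π_{ξ,ξ}(s) = ⟨π(s)ξ, ξ⟩`, i.e. the function of positive type
associated with `π` and `ξ`. (Mathlib's inner product is conjugate-linear in the first variable.) -/
def coeff (π : UnitaryRep.{u} Γ) (ξ : π.space) (s : Γ) : ℂ :=
  Inner.inner ℂ ξ (π.toHom s ξ)

/-- The set of all `σ` such that some finite sum of functions of positive type associated with `σ`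
is within `ε` of `π_{ξ,ξ}` on `Q`. -/
def fellNhd (π : UnitaryRep.{u} Γ) (ξ : π.space) (Q : Set Γ) (ε : ℝ) : Set (UnitaryRep.{u} Γ) :=
  {σ | ∃ (m : ℕ) (η : Fin m → σ.space),
    ∀ s ∈ Q, ‖π.coeff ξ s - ∑ k, σ.coeff (η k) s‖ < ε}

/-- The Fell topology: it is generated by the sets `fellNhd π ξ Q ε` with `Q` compact and `ε > 0`
(finite intersections of these with a common `π`, `Q`, `ε` are the usual basic open sets). -/
instance fellTopology : TopologicalSpace (UnitaryRep.{u} Γ) :=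
  TopologicalSpace.generateFrom
    {W | ∃ (π : UnitaryRep.{u} Γ) (ξ : π.space) (Q : Set Γ) (ε : ℝ),
      IsCompact Q ∧ 0 < ε ∧ W = fellNhd π ξ Q ε}

/-- The representation `π ∘ φ` for a continuous homomorphism `φ`. -/
def comp {Γ' : Type*} [Group Γ'] [TopologicalSpace Γ'] (π : UnitaryRep.{u} Γ') (φ : Γ →* Γ')
    (hφ : Continuous φ) : UnitaryRep.{u} Γ where
  space := π.space
  toHom := π.toHom.comp φ
  continuous_apply ξ := (π.continuous_apply ξ).comp hφ

end UnitaryRep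

/-- A homomorphism from a group into the monoid of linear isometries takes values in the unitary
operators. -/
def unitaryOfIsometry {Γ E : Type*} [Group Γ] [NormedAddCommGroup E] [InnerProductSpace ℂ E]
    (T : Γ →* (E →ₗᵢ[ℂ] E)) : Γ →* (E ≃ₗᵢ[ℂ] E) where
  toFun s :=
    { (T s).toLinearMap with
      invFun := T s⁻¹
      left_inv := fun x => by change (T s⁻¹ * T s) x = x; rw [← map_mul]; simp
      right_inv := fun x => by change (T s * T s⁻¹) x = x; rw [← map_mul]; simp
      norm_map' := (T s).norm_map }
  map_one' := by ext x; change T 1 x = x; simp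
  map_mul' s t := by ext x; change T (s * t) x = T s (T t x); simp

end Representations

/-! ### Regular representations -/

section Regular

theorem exists_hasCompactSupport_eLpNorm_sub_le {X : Type*} [TopologicalSpace X] [RegularSpace X]
    [LocallyCompactSpace X] [MeasurableSpace X] [BorelSpace X] (μ : Measure X) [μ.Regular]
    {f : X → ℂ} (hf : MemLp f 2 μ) {ε : ℝ≥0∞} (hε : ε ≠ 0) :
    ∃ g : X → ℂ, eLpNorm (f - g) 2 μ ≤ ε ∧ Continuous g ∧ MemLp g 2 μ ∧ HasCompactSupport g := by
  apply hf.induction_dense (by simp) _ _ _ _ hε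
  rotate_left
  · rintro f g ⟨f_cont, f_mem, hf⟩ ⟨g_cont, g_mem, hg⟩
    exact ⟨f_cont.add g_cont, f_mem.add g_mem, hf.add hg⟩
  · rintro f ⟨_, f_mem, _⟩
    exact f_mem.aestronglyMeasurable
  intro c t ht htμ ε hε
  rcases exists_Lp_half ℂ μ 2 hε with ⟨δ, δpos, hδ⟩
  obtain ⟨η, ηpos, hη⟩ :
      ∃ η : ℝ≥0, 0 < η ∧ ∀ s : Set X, μ s ≤ η → eLpNorm (s.indicator fun _x => c) 2 μ ≤ δ :=
    exists_eLpNorm_indicator_le (by simp) c δpos.ne'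
  have hη_pos' : (0 : ℝ≥0∞) < η := ENNReal.coe_pos.2 ηpos
  obtain ⟨s, st, s_compact, s_closed, μs⟩ :
      ∃ s, s ⊆ t ∧ IsCompact s ∧ IsClosed s ∧ μ (t \ s) < η :=
    ht.exists_isCompact_isClosed_sdiff_lt htμ.ne hη_pos'.ne'
  have hsμ : μ s ≠ ∞ := ((measure_mono st).trans_lt htμ).ne
  have I1 : eLpNorm ((s.indicator fun _y => c) - t.indicator fun _y => c) 2 μ ≤ δ := by
    rw [← eLpNorm_neg, neg_sub, ← Set.indicator_sdiff st]
    exact hη _ μs.le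
  obtain ⟨u, su, u_open, hu⟩ : ∃ u, u ⊇ s ∧ IsOpen u ∧ μ u < μ s + η :=
    s.exists_isOpen_lt_add hsμ hη_pos'.ne'
  have hus : μ (u \ s) ≤ η := by
    rw [measure_sdiff su s_closed.measurableSet.nullMeasurableSet hsμ]
    exact tsub_le_iff_left.2 hu.le
  obtain ⟨φ, φs, φu, φc, φI⟩ := exists_continuous_one_zero_of_isCompact s_compact
    u_open.isClosed_compl (Set.disjoint_compl_right_iff_subset.2 su)
  have gcont : Continuous fun x => φ x • c := φ.continuous.smul continuous_const
  have gsupp : HasCompactSupport fun x => φ x • c := φc.smul_right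
  have gmem : MemLp (fun x => φ x • c) 2 μ := gcont.memLp_of_hasCompactSupport gsupp
  have I2 : eLpNorm ((fun x => φ x • c) - s.indicator fun _y => c) 2 μ ≤ δ := by
    refine (eLpNorm_mono fun x => ?_).trans (hη _ hus)
    by_cases hxs : x ∈ s
    · simp [hxs, φs hxs]
    · by_cases hxu : x ∈ u
      · have h1 := φI x
        simp only [Pi.sub_apply, hxs, not_false_eq_true, Set.indicator_of_notMem, sub_zero,
          Set.mem_sdiff, hxu, and_self, Set.indicator_of_mem, norm_smul, Real.norm_eq_abs,
          abs_of_nonneg h1.1]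
        exact mul_le_of_le_one_left (norm_nonneg _) h1.2
      · simp [hxs, hxu, φu hxu]
  refine ⟨fun x => φ x • c, ?_, gcont, gmem, gsupp⟩
  have := (hδ _ _ (gmem.aestronglyMeasurable.sub
      (aestronglyMeasurable_const.indicator s_closed.measurableSet))
    ((aestronglyMeasurable_const.indicator s_closed.measurableSet).sub
      (aestronglyMeasurable_const.indicator ht)) I2 I1).le
  rwa [sub_add_sub_cancel] at this

theorem continuous_integral_mul_right {G : Type*} [TopologicalSpace G] [MeasurableSpace G]
    [OpensMeasurableSpace G] (μ : Measure G) [IsFiniteMeasureOnCompacts μ]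
    {E : Type*} [NormedAddCommGroup E] [NormedSpace ℝ E]
    {F : G → G → E} {S : Set G} (hS : IsCompact S)
    (hF : Continuous F.uncurry) (t₀ : G) {V : Set G} (hV : V ∈ 𝓝 t₀)
    (h0 : ∀ t ∈ V, ∀ x ∉ S, F t x = 0) :
    ContinuousAt (fun t => ∫ x, F t x ∂μ) t₀ :=
  (continuousOn_integral_of_compact_support hS hF.continuousOn
    (fun p x hp hx => h0 p hp x hx)).continuousAt hV

variable {G : Type*} [Group G] [TopologicalSpace G] [IsTopologicalGroup G] [LocallyCompactSpace G]

/-- The modular function `Δ`, normalized by `∫ f(xt) dx = Δ(t)⁻¹ ∫ f(x) dx` for a left Haar measure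
`dx`; Mathlib's `modularCharacter` is its inverse. -/
def modularFunction (t : G) : ℝ≥0 := (modularCharacter t)⁻¹

theorem modularFunction_pos (t : G) : 0 < modularFunction t :=
  inv_pos.2 (modularCharacterFun_pos t)

open scoped Pointwise in
theorem exists_isCompact_mul_right {E : Type*} [Zero E] {g : G → E} (hg : HasCompactSupport g)
    (t₀ : G) : ∃ S : Set G, IsCompact S ∧ ∃ V ∈ 𝓝 t₀, t₀ ∈ V ∧
      ∀ t ∈ V, ∀ x ∉ S, g (x * t) = 0 := by
  obtain ⟨V, hV, hVn⟩ := exists_compact_mem_nhds t₀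
  refine ⟨tsupport g * V⁻¹, IsCompact.mul hg hV.inv, V, hVn, mem_of_mem_nhds hVn,
    fun t ht x hx => ?_⟩
  by_contra h
  exact hx ⟨x * t, subset_tsupport _ h, t⁻¹, by simpa using ht, by simp⟩

section

variable [MeasurableSpace G] [BorelSpace G] (μ : Measure G) [μ.IsHaarMeasure] [μ.Regular]

theorem map_mul_right_eq_modularFunction (t : G) :
    map (fun x => x * t) μ = (modularFunction t)⁻¹ • μ := by
  have : Regular (map (fun x => x * t) μ) :=
    Regular.map (Homeomorph.mulRight t)
  rw [modularFunction, inv_inv]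
  change _ = modularCharacterFun t • μ
  rw [modularCharacterFun_eq_haarScalarFactor μ t]
  exact isMulLeftInvariant_eq_smul_of_regular _ μ

theorem integral_mul_right_eq_modularFunction {E : Type*} [NormedAddCommGroup E] [NormedSpace ℝ E]
    {f : G → E} (hf : Continuous f) (hc : HasCompactSupport f) (t : G) :
    ∫ x, f (x * t) ∂μ = (modularFunction t : ℝ)⁻¹ • ∫ x, f x ∂μ := by
  have h := integral_map (μ := μ) (f := f) (measurable_mul_const t).aemeasurable
    (hf.stronglyMeasurable_of_hasCompactSupport hc).aestronglyMeasurable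
  rw [← h, map_mul_right_eq_modularFunction, integral_smul_nnreal_measure, NNReal.smul_def,
    NNReal.coe_inv]

end

theorem continuous_modularFunction : Continuous (modularFunction : G → ℝ≥0) := by
  borelize G
  obtain ⟨⟨f, f_cont⟩, f_comp, f_nonneg, f_one⟩ :
    ∃ f : C(G, ℝ), HasCompactSupport f ∧ 0 ≤ f ∧ f 1 ≠ 0 := exists_continuous_nonneg_pos 1
  have hpos : 0 < ∫ x, f x ∂(haar : Measure G) :=
    f_cont.integral_pos_of_hasCompactSupport_nonneg_nonzero f_comp f_nonneg f_one
  have hD : Continuous fun t : G => ∫ x, f (x * t) ∂(haar : Measure G) := by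
    rw [continuous_iff_continuousAt]
    intro t₀
    obtain ⟨S, hS, V, hV, -, h0⟩ := exists_isCompact_mul_right f_comp t₀
    exact continuous_integral_mul_right haar (F := fun t x => f (x * t)) hS
      (f_cont.comp (continuous_snd.mul continuous_fst)) t₀ hV h0
  have hΔ : ∀ t : G, ((modularFunction t : ℝ≥0) : ℝ)
      = (∫ x, f x ∂(haar : Measure G)) / ∫ x, f (x * t) ∂(haar : Measure G) := by
    intro t
    have := modularFunction_pos t
    rw [integral_mul_right_eq_modularFunction haar f_cont f_comp t, smul_eq_mul]
    field_simp
  have hc : Continuous fun t : G => ((modularFunction t : ℝ≥0) : ℝ) := by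
    rw [funext hΔ]
    refine continuous_const.div hD fun t => ?_
    have := modularFunction_pos t
    rw [integral_mul_right_eq_modularFunction haar f_cont f_comp t, smul_eq_mul]
    exact (mul_pos (inv_pos.2 (NNReal.coe_pos.2 this)) hpos).ne'
  exact continuous_induced_rng.2 hc

variable [MeasurableSpace G] [BorelSpace G] (μ : Measure G) [μ.IsHaarMeasure] [μ.Regular]

/-- The left regular representation on `L²(G)`: `(λ(s)f)(x) = f(s⁻¹x)`. -/
def leftRegular : G →* (Lp ℂ 2 μ ≃ₗᵢ[ℂ] Lp ℂ 2 μ) :=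
  unitaryOfIsometry
    { toFun := fun s => Lp.compMeasurePreservingₗᵢ ℂ (fun x => s⁻¹ * x)
        (measurePreserving_mul_left μ s⁻¹)
      map_one' := by
        ext1 f
        apply Lp.ext
        refine (Lp.coeFn_compMeasurePreserving f (measurePreserving_mul_left μ (1 : G)⁻¹)).trans ?_
        exact Eventually.of_forall fun x => by simp
      map_mul' := fun s t => by
        ext1 f
        apply Lp.ext
        refine (Lp.coeFn_compMeasurePreserving f
          (measurePreserving_mul_left μ (s * t)⁻¹)).trans ?_
        symm
        refine (Lp.coeFn_compMeasurePreserving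
          (Lp.compMeasurePreservingₗᵢ ℂ _ (measurePreserving_mul_left μ t⁻¹) f)
          (measurePreserving_mul_left μ s⁻¹)).trans ?_
        have h := (measurePreserving_mul_left μ s⁻¹).quasiMeasurePreserving.ae_eq_comp
          (Lp.coeFn_compMeasurePreserving f (measurePreserving_mul_left μ t⁻¹))
        refine h.trans (Eventually.of_forall fun x => ?_)
        simp [mul_assoc] }

theorem quasiMeasurePreserving_mul_right' (t : G) :
    QuasiMeasurePreserving (fun x => x * t) μ μ :=
  ⟨measurable_mul_const t, by
    rw [map_mul_right_eq_modularFunction]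
    exact smul_absolutelyContinuous⟩

theorem eLpNorm_sqrt_smul_mul_right {f : G → ℂ} (hf : AEStronglyMeasurable f μ) (t : G) :
    eLpNorm (fun x => √(modularFunction t : ℝ) • f (x * t)) 2 μ = eLpNorm f 2 μ := by
  have hΔ := modularFunction_pos t
  have h1 : eLpNorm (fun x => f (x * t)) 2 μ = eLpNorm f 2 ((modularFunction t)⁻¹ • μ) := by
    rw [← map_mul_right_eq_modularFunction]
    refine (eLpNorm_map_measure ?_ (measurable_mul_const t).aemeasurable).symm
    exact hf.mono_ac (quasiMeasurePreserving_mul_right' μ t).absolutelyContinuous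
  have h2 : (fun x => √(modularFunction t : ℝ) • f (x * t))
      = √(modularFunction t : ℝ) • fun x => f (x * t) := rfl
  rw [h2, eLpNorm_const_smul, h1]
  have h3 : ‖√(modularFunction t : ℝ)‖ₑ = (modularFunction t : ℝ≥0∞) ^ (1 / 2 : ℝ) := by
    rw [← Real.coe_sqrt, Real.enorm_of_nonneg (NNReal.coe_nonneg _), ENNReal.ofReal_coe_nnreal,
      NNReal.sqrt_eq_rpow, ENNReal.coe_rpow_of_nonneg _ (by norm_num)]
  have h4 : ((modularFunction t)⁻¹ • μ) = ((modularFunction t : ℝ≥0∞)⁻¹) • μ := by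
    rw [← ENNReal.coe_inv hΔ.ne']; rfl
  rw [h3, h4, eLpNorm_smul_measure_of_ne_top (by simp), smul_eq_mul, ← mul_assoc]
  have h5 : (1 / (2 : ℝ≥0∞)).toReal = (1 / 2 : ℝ) := by simp
  rw [h5, ← ENNReal.mul_rpow_of_nonneg _ _ (by norm_num),
    ENNReal.mul_inv_cancel (by simpa using hΔ.ne') (by simp), ENNReal.one_rpow, one_mul]

theorem memLp_sqrt_smul_mul_right {f : G → ℂ} (hf : MemLp f 2 μ) (t : G) :
    MemLp (fun x => √(modularFunction t : ℝ) • f (x * t)) 2 μ :=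
  ⟨(hf.1.comp_quasiMeasurePreserving (quasiMeasurePreserving_mul_right' μ t)).const_smul
    √(modularFunction t : ℝ), by
    rw [eLpNorm_sqrt_smul_mul_right μ hf.1]; exact hf.2⟩

/-- The operator `ρ(t)` on `L²(G)`: `(ρ(t)f)(x) = Δ(t)^{1/2} f(xt)`. -/
def rightRegularIsometry (t : G) : Lp ℂ 2 μ →ₗᵢ[ℂ] Lp ℂ 2 μ where
  toFun f := (memLp_sqrt_smul_mul_right μ (Lp.memLp f) t).toLp
    (fun x => √(modularFunction t : ℝ) • f (x * t))
  map_add' f g := by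
    rw [← MemLp.toLp_add]
    refine MemLp.toLp_congr _ _ ?_
    filter_upwards [(quasiMeasurePreserving_mul_right' μ t).ae_eq_comp (Lp.coeFn_add f g)]
      with x hx
    simp only [Function.comp_apply, Pi.add_apply] at hx ⊢
    rw [hx, smul_add]
  map_smul' c f := by
    rw [← MemLp.toLp_const_smul]
    refine MemLp.toLp_congr _ _ ?_
    filter_upwards [(quasiMeasurePreserving_mul_right' μ t).ae_eq_comp (Lp.coeFn_smul c f)]
      with x hx
    simp only [Function.comp_apply, Pi.smul_apply, RingHom.id_apply] at hx ⊢
    rw [hx, smul_comm]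
  norm_map' f := by
    change ‖(memLp_sqrt_smul_mul_right μ (Lp.memLp f) t).toLp _‖ = _
    rw [Lp.norm_toLp, eLpNorm_sqrt_smul_mul_right μ (Lp.memLp f).1, Lp.norm_def]

theorem coeFn_rightRegularIsometry (t : G) (f : Lp ℂ 2 μ) :
    rightRegularIsometry μ t f =ᵐ[μ] fun x => √(modularFunction t : ℝ) • f (x * t) :=
  MemLp.coeFn_toLp (memLp_sqrt_smul_mul_right μ (Lp.memLp f) t)

/-- The right regular representation on `L²(G)`: `(ρ(t)f)(x) = Δ(t)^{1/2} f(xt)`. -/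
def rightRegular : G →* (Lp ℂ 2 μ ≃ₗᵢ[ℂ] Lp ℂ 2 μ) :=
  unitaryOfIsometry
    { toFun := rightRegularIsometry μ
      map_one' := by
        ext1 f
        apply Lp.ext
        refine (coeFn_rightRegularIsometry μ 1 f).trans ?_
        exact Eventually.of_forall fun x => by simp [modularFunction]
      map_mul' := fun s t => by
        ext1 f
        apply Lp.ext
        refine (coeFn_rightRegularIsometry μ (s * t) f).trans ?_
        symm
        refine (coeFn_rightRegularIsometry μ s (rightRegularIsometry μ t f)).trans ?_
        filter_upwards [(quasiMeasurePreserving_mul_right' μ s).ae_eq_comp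
          (coeFn_rightRegularIsometry μ t f)] with x hx
        simp only [Function.comp_apply] at hx
        rw [hx, smul_smul, ← Real.sqrt_mul (modularFunction s).coe_nonneg, mul_assoc]
        simp [modularFunction, mul_comm] }

set_option linter.unusedSectionVars false in
theorem coeFn_leftRegular (s : G) (f : Lp ℂ 2 μ) :
    leftRegular μ s f =ᵐ[μ] fun x => f (s⁻¹ * x) :=
  Lp.coeFn_compMeasurePreserving f (measurePreserving_mul_left μ s⁻¹)

theorem coeFn_rightRegular (t : G) (f : Lp ℂ 2 μ) :
    rightRegular μ t f =ᵐ[μ] fun x => √(modularFunction t : ℝ) • f (x * t) :=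
  coeFn_rightRegularIsometry μ t f

theorem commute_leftRegular_rightRegular (s t : G) :
    Commute (leftRegular μ s) (rightRegular μ t) := by
  ext1 f
  apply Lp.ext
  change leftRegular μ s (rightRegular μ t f) =ᵐ[μ] rightRegular μ t (leftRegular μ s f)
  refine (coeFn_leftRegular μ s _).trans ?_
  refine ((measurePreserving_mul_left μ s⁻¹).quasiMeasurePreserving.ae_eq_comp
    (coeFn_rightRegular μ t f)).trans ?_
  symm
  refine (coeFn_rightRegular μ t _).trans ?_
  filter_upwards [(quasiMeasurePreserving_mul_right' μ t).ae_eq_comp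
    (coeFn_leftRegular μ s f)] with x hx
  simp only [Function.comp_apply] at hx ⊢
  rw [hx, mul_assoc]

theorem continuous_leftRegular (f : Lp ℂ 2 μ) : Continuous fun s => leftRegular μ s f := by
  let φ : G → C(G, G) := fun s => (ContinuousMap.mk
    (fun p : G × G => p.1⁻¹ * p.2) (by fun_prop)).curry s
  have hφ : Continuous φ := ContinuousMap.continuous _
  exact (continuous_const (y := f)).compMeasurePreservingLp hφ
    (fun s => measurePreserving_mul_left μ s⁻¹) (by simp)

theorem continuous_rightRegular (f : Lp ℂ 2 μ) : Continuous fun t => rightRegular μ t f := by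
  have key : ∀ (g : G → ℂ) (_ : Continuous g) (_ : HasCompactSupport g) (hm : MemLp g 2 μ),
      Continuous fun t => rightRegular μ t (hm.toLp g) := by
    intro g hg hc hm
    rw [continuous_iff_continuousAt]
    intro t₀
    rw [ContinuousAt, tendsto_iff_norm_sub_tendsto_zero]
    let h : G → G → ℂ := fun t x => √(modularFunction t : ℝ) • g (x * t)
    have hh : ∀ t, MemLp (h t) 2 μ := fun t => memLp_sqrt_smul_mul_right μ hm t
    have hρ : ∀ t, rightRegular μ t (hm.toLp g) = (hh t).toLp (h t) := by
      intro t
      apply Lp.ext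
      refine (coeFn_rightRegular μ t _).trans (EventuallyEq.trans ?_ (hh t).coeFn_toLp.symm)
      filter_upwards [(quasiMeasurePreserving_mul_right' μ t).ae_eq_comp hm.coeFn_toLp] with x hx
      simp only [Function.comp_apply] at hx
      rw [hx]
    obtain ⟨S, hS, V, hV, htV, h0⟩ := exists_isCompact_mul_right hc t₀
    have hcont : Continuous (Function.uncurry fun t x => ‖h t x - h t₀ x‖ ^ (2 : ℝ)) := by
      have hm' : Continuous fun t : G => √(modularFunction t : ℝ) :=
        (NNReal.continuous_coe.comp continuous_modularFunction).sqrt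
      have hh1 : Continuous fun p : G × G => h p.1 p.2 :=
        (hm'.comp continuous_fst).smul (hg.comp (continuous_snd.mul continuous_fst))
      have hh2 : Continuous fun p : G × G => h t₀ p.2 :=
        (hg.comp (continuous_snd.mul continuous_const)).const_smul √(modularFunction t₀ : ℝ)
      exact (hh1.sub hh2).norm.rpow_const fun _ => Or.inr (by norm_num)
    have hI : ContinuousAt (fun t => ∫ x, ‖h t x - h t₀ x‖ ^ (2 : ℝ) ∂μ) t₀ := by
      refine continuous_integral_mul_right μ hS hcont t₀ hV fun t ht x hx => ?_
      simp [h, h0 t ht x hx, h0 t₀ htV x hx]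
    have hn : ∀ t, ‖rightRegular μ t (hm.toLp g) - rightRegular μ t₀ (hm.toLp g)‖
        = (∫ x, ‖h t x - h t₀ x‖ ^ (2 : ℝ) ∂μ) ^ (2 : ℝ)⁻¹ := by
      intro t
      rw [hρ, hρ, ← MemLp.toLp_sub, Lp.norm_toLp,
        ((hh t).sub (hh t₀)).eLpNorm_eq_integral_rpow_norm (by simp) (by simp),
        ENNReal.toReal_ofReal (by positivity)]
      simp
    simp_rw [hn]
    have := hI.tendsto.rpow_const (p := (2 : ℝ)⁻¹) (Or.inr (by norm_num))
    simpa using this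
  rw [continuous_iff_continuousAt]
  intro t₀
  rw [ContinuousAt, Metric.tendsto_nhds]
  intro ε hε
  obtain ⟨g, hfg, hg, hm, hc⟩ := exists_hasCompactSupport_eLpNorm_sub_le μ (Lp.memLp f)
    (ε := ENNReal.ofReal (ε / 4)) (by simpa using hε)
  have hd : ‖f - hm.toLp g‖ ≤ ε / 4 := by
    have h1 : f - hm.toLp g = ((Lp.memLp f).sub hm).toLp _ := by
      rw [MemLp.toLp_sub (Lp.memLp f) hm, Lp.toLp_coeFn]
    rw [h1, Lp.norm_toLp]
    exact ENNReal.toReal_le_of_le_ofReal (by positivity) hfg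
  filter_upwards [Metric.tendsto_nhds.1 ((key g hg hc hm).tendsto t₀) (ε / 4) (by positivity)]
    with t ht
  have e1 : ∀ t, dist (rightRegular μ t f) (rightRegular μ t (hm.toLp g)) ≤ ε / 4 := fun t => by
    rw [(rightRegular μ t).dist_map, dist_eq_norm]; exact hd
  have e2 := dist_triangle4 (rightRegular μ t f) (rightRegular μ t (hm.toLp g))
    (rightRegular μ t₀ (hm.toLp g)) (rightRegular μ t₀ f)
  have e3 := e1 t
  have e4 := e1 t₀
  rw [dist_comm] at e4
  linarith

/-- The representation `λ·ρ` of `G × G` on `L²(G)`: `(λ·ρ)(s,t) = λ(s)ρ(t)`. -/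
def biregular : UnitaryRep (G × G) where
  space := Lp ℂ 2 μ
  toHom := (leftRegular μ).noncommCoprod (rightRegular μ) (commute_leftRegular_rightRegular μ)
  continuous_apply f := by
    rw [continuous_iff_continuousAt]
    rintro ⟨s₀, t₀⟩
    rw [ContinuousAt, tendsto_iff_norm_sub_tendsto_zero]
    have h1 : Tendsto _ _ _ := ((continuous_leftRegular μ (rightRegular μ t₀ f)).sub
      (continuous_const (y := leftRegular μ s₀ (rightRegular μ t₀ f)))).norm.tendsto s₀
    have h2 : Tendsto _ _ _ := ((continuous_rightRegular μ f).sub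
      (continuous_const (y := rightRegular μ t₀ f))).norm.tendsto t₀
    have h := ((h2.comp (continuous_snd.tendsto (s₀, t₀))).add
      (h1.comp (continuous_fst.tendsto (s₀, t₀))))
    simp only [Pi.sub_apply, sub_self, norm_zero, add_zero] at h
    refine squeeze_zero (fun _ => norm_nonneg _) (fun p => ?_) h
    change ‖leftRegular μ p.1 (rightRegular μ p.2 f) - leftRegular μ s₀ (rightRegular μ t₀ f)‖
      ≤ ‖rightRegular μ p.2 f - rightRegular μ t₀ f‖
        + ‖leftRegular μ p.1 (rightRegular μ t₀ f) - leftRegular μ s₀ (rightRegular μ t₀ f)‖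
    rw [← (leftRegular μ p.1).norm_map (rightRegular μ p.2 f - rightRegular μ t₀ f), map_sub]
    exact norm_sub_le_norm_sub_add_norm_sub _ _ _

end Regular

/-! ### Quotients -/

/-- A quotient of a topological group carries its Borel σ-algebra. (Mathlib's default instance on
`G ⧸ N` is the quotient of the σ-algebra of `G`, which may differ from the Borel σ-algebra.) -/
instance quotientBorel {G : Type*} [Group G] [TopologicalSpace G] (N : Subgroup G) :
    MeasurableSpace (G ⧸ N) := borel (G ⧸ N)

instance quotientBorelSpace {G : Type*} [Group G] [TopologicalSpace G] (N : Subgroup G) :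
    BorelSpace (G ⧸ N) := ⟨rfl⟩

section Quotient

variable {G : Type*} [Group G] [TopologicalSpace G] [IsTopologicalGroup G] [LocallyCompactSpace G]

/-- The representation `(s,t) ↦ λ_{G/N}(ṡ) ρ_{G/N}(ṫ)` of `G × G` on `L²(G/N)`, where `m` is the
left Haar measure on `G/N`. -/
def quotientBiregular (N : Subgroup G) [N.Normal] (m : Measure (G ⧸ N)) [m.IsHaarMeasure]
    [m.Regular] : UnitaryRep (G × G) :=
  (biregular m).comp ((QuotientGroup.mk' N).prodMap (QuotientGroup.mk' N))
    ((QuotientGroup.continuous_mk.comp continuous_fst).prodMk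
      (QuotientGroup.continuous_mk.comp continuous_snd))

end Quotient

end

/-! A function f in C_c(G) is averaged over N = N_α to F(xN) = ∫_N f(xn) dν(n). By Weil's formula, a
suitable multiple of F has coefficient Δ_{G/N}(t)^{1/2} ∫_G conj(f(x)) F(s⁻¹xt) dx under σ_α, an
integral over G itself (`exists_quotientBiregular_coeff_eq`). The coefficient of λ_G·ρ_G at f is the
same expression with Δ_G and f in place of Δ_{G/N} and F, so two comparisons remain, for (s,t) in a
compact set Q.

Both come from one compact neighbourhood V of 1, large enough to contain every n with f(yn) ≠ 0,
where y runs over the compact set of points s⁻¹xt with x in the support of f. For large α, N ∩ V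
lies in a prescribed small neighbourhood U of 1, and ν is normalized by ν(N ∩ V) = 1.

Averages: for these y, F(yN) is the mean over N ∩ V of values f(yn) that are close to f(y)
(`norm_pushforward_sub_le`).

Modular functions: if U is so small that conjugation by t and by t⁻¹ maps U into V, then N ∩ V is
invariant under conjugation by t. Its measure is positive and finite, so this conjugation preserves
ν, which forces Δ_{G/N}(t) = Δ_G(t) exactly (`modularFunction_mk_eq`).

Density of C_c(G) in L²(G) handles the other vectors. Each coefficient of the limit is thus
approximated by a single coefficient of σ_α, which suffices for Fell convergence. -/

open scoped CompactlySupported ComplexConjugate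

/-! ### Weil's integration formula -/

namespace TopologicalGroup.IsSES

variable {A B C : Type*} [Group A] [Group B] [Group C]
  [TopologicalSpace A] [TopologicalSpace B] [TopologicalSpace C]
  {φ : A →* B} {ψ : B →* C} (H : TopologicalGroup.IsSES φ ψ)
  [IsTopologicalGroup A] [IsTopologicalGroup B] [IsTopologicalGroup C] [LocallyCompactSpace B]
  [MeasurableSpace A] [BorelSpace A] (μA : Measure A) [IsHaarMeasure μA]
  [MeasurableSpace C] [BorelSpace C] (μC : Measure C) [IsHaarMeasure μC]
  [T2Space B] [MeasurableSpace B] [BorelSpace B]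

/-- Weil's integration formula for complex-valued functions. -/
theorem integral_inducedMeasure_complex (f : C_c(B, ℂ)) :
    ∫ b, f b ∂(inducedMeasure H μA μC) = ∫ c, pushforward H μA f c ∂μC := by
  have hf : Integrable f (inducedMeasure H μA μC) := f.integrable
  have hF : Integrable (pushforward H μA f) μC := (pushforward H μA f).integrable
  -- The formula for real-valued functions is applied to T ∘ f, with T the real or the imaginary
  -- part.
  have key (T : ℂ →L[ℝ] ℝ) :
      T (∫ b, f b ∂(inducedMeasure H μA μC)) = T (∫ c, pushforward H μA f c ∂μC) := by
    let g : C_c(B, ℝ) := ⟨⟨fun b => T (f b), T.continuous.comp f.continuous⟩,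
      f.hasCompactSupport.comp_left (map_zero T)⟩
    rw [← T.integral_comp_comm hf, ← T.integral_comp_comm hF]
    refine (integral_inducedMeasure H μA μC g).trans ?_
    rw [integrate_apply]
    congr 1 with c
    rw [pushforward_def, pushforward_def, ← T.integral_comp_comm (pullback H f _).integrable]
    rfl
  exact Complex.ext (key Complex.reCLM) (key Complex.imCLM)

/-- Weil's integration formula with respect to an arbitrary Haar measure on the middle group. -/
theorem exists_pos_integral_pushforward_eq (μB : Measure B) [IsHaarMeasure μB] [μB.Regular] :
    ∃ c : ℝ, 0 < c ∧ ∀ f : C_c(B, ℂ),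
      ∫ x, pushforward H μA f x ∂μC = (c : ℂ) * ∫ b, f b ∂μB := by
  refine ⟨haarScalarFactor (inducedMeasure H μA μC) μB,
    NNReal.coe_pos.2 (haarScalarFactor_pos_of_isHaarMeasure _ _), fun f => ?_⟩
  have h := congrArg (fun ν : Measure B => ∫ b, f b ∂ν)
    (isMulLeftInvariant_eq_smul_of_regular (inducedMeasure H μA μC) μB)
  simp only [integral_smul_nnreal_measure] at h
  rw [← integral_inducedMeasure_complex, h, NNReal.smul_def, Complex.real_smul]

end TopologicalGroup.IsSES

/-! ### Conjugation on a normal subgroup and its Haar measure -/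

section Conjugation

variable {G : Type*} [Group G] [TopologicalSpace G] [IsTopologicalGroup G]

/-- Conjugation by `t` as an automorphism of the topological group `N`. -/
def conjNormalContinuous (N : Subgroup G) [N.Normal] (t : G) : N ≃ₜ* N where
  __ := (MulAut.conjNormal t : MulAut N)
  continuous_toFun := Continuous.subtype_mk
    (f := fun n : N => t * n * t⁻¹) (by fun_prop) _
  continuous_invFun := by
    refine Continuous.congr (f := fun n : N => MulAut.conjNormal t⁻¹ n) ?_ fun n => ?_
    · exact Continuous.subtype_mk (f := fun n : N => t⁻¹ * n * t⁻¹⁻¹) (by fun_prop) _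
    · rw [map_inv]; rfl

theorem coe_conjNormalContinuous (N : Subgroup G) [N.Normal] (t : G) (n : N) :
    (conjNormalContinuous N t n : G) = t * n * t⁻¹ :=
  rfl

/-- An automorphism which leaves invariant a set of positive finite measure preserves the Haar
measure. -/
theorem measurePreserving_of_preimage_eq {H : Type*} [Group H] [TopologicalSpace H]
    [IsTopologicalGroup H] [LocallyCompactSpace H] [MeasurableSpace H] [BorelSpace H]
    (ν : Measure H) [ν.IsHaarMeasure] [ν.Regular] (φ : H ≃ₜ* H) {X : Set H} (h0 : ν X ≠ 0)
    (hX : ν X ≠ ∞) (h : φ ⁻¹' X = X) : MeasurePreserving φ ν ν := by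
  -- The modulus d of φ satisfies d · ν(φ⁻¹X) = ν(X); invariance of X then gives d = 1.
  have h1 := mulEquivHaarChar_smul_preimage ν (X := X) φ
  rw [h, ENNReal.smul_def, smul_eq_mul] at h1
  have h2 : mulEquivHaarChar φ = 1 := by
    exact_mod_cast (ENNReal.mul_eq_right h0 hX).1 h1
  have h3 := mulEquivHaarChar_smul_map ν φ
  rw [h2, one_smul] at h3
  exact ⟨φ.continuous_toFun.measurable, h3⟩

end Conjugation

/-! ### Modular functions of a group and its quotient -/

section Modular

variable {G : Type*} [Group G] [TopologicalSpace G] [IsTopologicalGroup G] [LocallyCompactSpace G]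
  [T2Space G] [MeasurableSpace G] [BorelSpace G]

/-- If conjugation by `t` preserves the Haar measure of `N`, then the modular functions of `G` and
`G ⧸ N` agree at `t`. -/
theorem modularFunction_mk_eq (N : Subgroup G) [N.Normal] (hc : IsClosed (N : Set G))
    (ν : Measure N) [ν.IsHaarMeasure] (t : G)
    (ht : MeasurePreserving (conjNormalContinuous N t) ν ν) :
    modularFunction (t : G ⧸ N) = modularFunction t := by
  have H := TopologicalGroup.IsSES.ofClosedSubgroup N hc
  obtain ⟨c, hc0, hw⟩ :=
    H.exists_pos_integral_pushforward_eq ν (haar : Measure (G ⧸ N)) (haar : Measure G)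
  obtain ⟨⟨f, f_cont⟩, f_comp, f_nonneg, f_one⟩ :
    ∃ f : C(G, ℝ), HasCompactSupport f ∧ 0 ≤ f ∧ f 1 ≠ 0 := exists_continuous_nonneg_pos 1
  have hpos : 0 < ∫ x, f x ∂(haar : Measure G) :=
    f_cont.integral_pos_of_hasCompactSupport_nonneg_nonzero f_comp f_nonneg f_one
  let g : C_c(G, ℂ) := ⟨⟨fun x => (f x : ℂ), Complex.continuous_ofReal.comp f_cont⟩,
    f_comp.comp_left (g := ((↑) : ℝ → ℂ)) Complex.ofReal_zero⟩
  have hg : ∫ x, g x ∂(haar : Measure G) ≠ 0 := by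
    change ∫ x, (f x : ℂ) ∂(haar : Measure G) ≠ 0
    rw [integral_complex_ofReal]
    exact_mod_cast hpos.ne'
  let gt : C_c(G, ℂ) := ⟨⟨fun x => g (x * t), by fun_prop⟩,
    g.hasCompactSupport.comp_homeomorph (Homeomorph.mulRight t)⟩
  -- The substitution n ↦ tnt⁻¹, which preserves ν, turns g(xnt) into g(xtn): averaging over N
  -- commutes with right translation by t.
  have hpush (x : G ⧸ N) : H.pushforward ν gt x = H.pushforward ν g (x * t) := by
    obtain ⟨x, rfl⟩ := QuotientGroup.mk'_surjective N x
    rw [← QuotientGroup.mk'_apply (N := N) t, ← map_mul, H.pushforward_apply_apply,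
      H.pushforward_apply_apply,
      ← ht.integral_comp (conjNormalContinuous N t).toHomeomorph.measurableEmbedding]
    congr 1 with n
    change g (x * (t * n * t⁻¹) * t) = g (x * t * n)
    congr 1; group
  -- The integral of the translate is computed on both sides of Weil's formula; the quotient
  -- contributes Δ_{G/N}(t)⁻¹ and G contributes Δ_G(t)⁻¹.
  have h1 := hw gt
  simp_rw [hpush] at h1
  rw [integral_mul_right_eq_modularFunction haar (f := ⇑(H.pushforward ν g))
    (H.pushforward ν g).continuous
    (H.pushforward ν g).hasCompactSupport, hw g] at h1
  change _ = (c : ℂ) * ∫ x, g (x * t) ∂haar at h1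
  rw [integral_mul_right_eq_modularFunction haar (f := ⇑g) g.continuous g.hasCompactSupport,
    Complex.real_smul, Complex.real_smul, mul_left_comm] at h1
  have h2 := mul_right_cancel₀ hg (mul_left_cancel₀ (Complex.ofReal_ne_zero.2 hc0.ne') h1)
  exact inv_injective (by exact_mod_cast h2)

end Modular

/-! ### Coefficients of the biregular representation -/

section Coefficients

theorem CompactlySupportedContinuousMap.memLp_two {X : Type*} [TopologicalSpace X]
    [MeasurableSpace X] [BorelSpace X] (f : C_c(X, ℂ)) (μ : Measure X)
    [IsFiniteMeasureOnCompacts μ] : MemLp f 2 μ :=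
  f.continuous.memLp_of_hasCompactSupport f.hasCompactSupport

variable {G : Type*} [Group G] [TopologicalSpace G] [IsTopologicalGroup G] [LocallyCompactSpace G]
  [MeasurableSpace G] [BorelSpace G] (μ : Measure G) [μ.IsHaarMeasure] [μ.Regular]

theorem UnitaryRep.coeff_ofReal_smul {Γ : Type*} [Group Γ] [TopologicalSpace Γ] (π : UnitaryRep Γ)
    (r : ℝ) (ξ : π.space) (s : Γ) :
    π.coeff ((r : ℂ) • ξ) s = (r ^ 2 : ℝ) * π.coeff ξ s := by
  simp only [UnitaryRep.coeff, map_smul, inner_smul_left, inner_smul_right, Complex.conj_ofReal]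
  push_cast
  ring

theorem biregular_coeff_toLp (f : C_c(G, ℂ)) (s t : G) :
    (biregular μ).coeff ((f.memLp_two μ).toLp f) (s, t)
      = √(modularFunction t : ℝ) * ∫ x, conj (f x) * f (s⁻¹ * x * t) ∂μ := by
  change Inner.inner ℂ ((f.memLp_two μ).toLp f)
    (leftRegular μ s (rightRegular μ t ((f.memLp_two μ).toLp f))) = _
  rw [L2.inner_def, ← integral_const_mul]
  refine integral_congr_ae ?_
  have hL := (measurePreserving_mul_left μ s⁻¹).quasiMeasurePreserving
  filter_upwards [(f.memLp_two μ).coeFn_toLp,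
    coeFn_leftRegular μ s (rightRegular μ t ((f.memLp_two μ).toLp f)),
    hL.ae_eq_comp (coeFn_rightRegular μ t ((f.memLp_two μ).toLp f)),
    hL.ae_eq_comp ((quasiMeasurePreserving_mul_right' μ t).ae_eq_comp
      (f.memLp_two μ).coeFn_toLp)] with x h1 h2 h3 h4
  simp only [Function.comp_apply] at h3 h4
  rw [h1, h2, h3, h4, RCLike.inner_apply, Complex.real_smul]
  ring

end Coefficients

/-! ### Uniform estimates -/

section Approximation

theorem UnitaryRep.norm_coeff_sub_le {Γ : Type*} [Group Γ] [TopologicalSpace Γ] (π : UnitaryRep Γ)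
    (ξ ζ : π.space) (s : Γ) :
    ‖π.coeff ξ s - π.coeff ζ s‖ ≤ ‖ξ - ζ‖ * (‖ξ‖ + ‖ζ‖) := by
  have h : π.coeff ξ s - π.coeff ζ s
      = Inner.inner ℂ (ξ - ζ) (π.toHom s ξ) + Inner.inner ℂ ζ (π.toHom s (ξ - ζ)) := by
    simp only [UnitaryRep.coeff, inner_sub_left, map_sub, inner_sub_right]
    ring
  rw [h, mul_add]
  refine (norm_add_le _ _).trans (add_le_add ?_ ?_)
  · exact (norm_inner_le_norm _ _).trans_eq (by rw [(π.toHom s).norm_map])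
  · exact (norm_inner_le_norm _ _).trans_eq (by rw [(π.toHom s).norm_map, mul_comm])

theorem UnitaryRep.continuous_coeff {Γ : Type*} [Group Γ] [TopologicalSpace Γ] (π : UnitaryRep Γ)
    (ξ : π.space) : Continuous (π.coeff ξ) :=
  continuous_const.inner (π.continuous_apply ξ)

variable {G : Type*} [Group G] [TopologicalSpace G] [IsTopologicalGroup G]

/-- Conjugation is jointly continuous and fixes 1, so compactness of K makes the neighbourhood of 1
uniform in t. -/
theorem eventually_conj_mem {K V : Set G} (hK : IsCompact K) (hV : V ∈ 𝓝 (1 : G)) :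
    ∀ᶠ u in 𝓝 (1 : G), ∀ t ∈ K, t * u * t⁻¹ ∈ V ∧ t⁻¹ * u * t ∈ V := by
  refine hK.eventually_forall_of_forall_eventually fun t _ => ?_
  have h1 : ContinuousAt (fun p : G × G => p.2 * p.1 * p.2⁻¹) (1, t) := by fun_prop
  have h2 : ContinuousAt (fun p : G × G => p.2⁻¹ * p.1 * p.2) (1, t) := by fun_prop
  exact (h1.eventually_mem (by simpa using hV)).and (h2.eventually_mem (by simpa using hV))

theorem eventually_norm_mul_right_sub_le {f : G → ℂ} (hf : Continuous f) {C : Set G}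
    (hC : IsCompact C) {δ : ℝ} (hδ : 0 < δ) :
    ∀ᶠ u in 𝓝 (1 : G), ∀ y ∈ C, ‖f (y * u) - f y‖ ≤ δ := by
  refine hC.eventually_forall_of_forall_eventually fun y _ => ?_
  have h : ContinuousAt (fun p : G × G => ‖f (p.2 * p.1) - f p.2‖) (1, y) := by fun_prop
  exact h.eventually_le_const (by simpa using hδ)

variable [MeasurableSpace G] [BorelSpace G]

/-- Points of N ∩ V lie in U, so conjugation by t and by t⁻¹ both map N ∩ V into itself. Hence N ∩ V
is an invariant set of positive finite measure. -/
theorem measurePreserving_conjNormalContinuous (N : Subgroup G) [N.Normal]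
    [LocallyCompactSpace N] (ν : Measure N) [ν.IsHaarMeasure] [ν.Regular] {U V : Set G}
    (h0 : ν (Subtype.val ⁻¹' V) ≠ 0) (htop : ν (Subtype.val ⁻¹' V) ≠ ∞)
    (hNV : (N : Set G) ∩ V ⊆ U)
    {t : G} (ht : ∀ u ∈ U, t * u * t⁻¹ ∈ V ∧ t⁻¹ * u * t ∈ V) :
    MeasurePreserving (conjNormalContinuous N t) ν ν := by
  refine measurePreserving_of_preimage_eq ν _ h0 htop
    (Set.ext fun n => ⟨fun hn => ?_, fun hn => ?_⟩)
  · have := (ht _ (hNV ⟨(conjNormalContinuous N t n).2, hn⟩)).2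
    rw [coe_conjNormalContinuous] at this
    have e : t⁻¹ * (t * n * t⁻¹) * t = n := by group
    rwa [e] at this
  · exact (ht _ (hNV ⟨n.2, hn⟩)).1

variable [LocallyCompactSpace G]

/-- Since n ↦ f(yn) vanishes off N ∩ V, a set of measure one, the pushforward at y is a mean of
values within δ of f(y). -/
theorem norm_pushforward_sub_le (N : Subgroup G) [N.Normal] (hc : IsClosed (N : Set G))
    (ν : Measure N) [ν.IsHaarMeasure] (f : C_c(G, ℂ)) {V : Set G}
    (hV : ν (Subtype.val ⁻¹' V) = 1) (y : G) {δ : ℝ}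
    (hsupp : ∀ n : N, f (y * n) ≠ 0 → (n : G) ∈ V)
    (hδ : ∀ n : N, (n : G) ∈ V → ‖f (y * n) - f y‖ ≤ δ) :
    ‖(TopologicalGroup.IsSES.ofClosedSubgroup N hc).pushforward ν f (y : G ⧸ N) - f y‖ ≤ δ := by
  have H := TopologicalGroup.IsSES.ofClosedSubgroup N hc
  have h1 : H.pushforward ν f (y : G ⧸ N) = ∫ n in Subtype.val ⁻¹' V, f (y * n) ∂ν := by
    rw [setIntegral_eq_integral_of_forall_compl_eq_zero fun n hn => ?_]
    · exact H.pushforward_apply_apply ν f y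
    · by_contra h
      exact hn (hsupp n h)
  have h2 : f y = ∫ n in Subtype.val ⁻¹' V, f y ∂ν := by simp [measureReal_def, hV]
  have hint : Integrable (fun n : N => f (y * n)) ν := (H.pullback f y).integrable
  rw [h1, h2, ← integral_sub hint.integrableOn (integrableOn_const (by simp [hV]))]
  simpa [measureReal_def, hV] using
    norm_setIntegral_le_of_norm_le_const (μ := ν) (s := Subtype.val ⁻¹' V)
      (f := fun n : N => f (y * n) - f y) (C := δ) (by simp [hV]) (fun n hn => hδ n hn)

variable (μ : Measure G) [μ.IsHaarMeasure] [μ.Regular]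

theorem exists_norm_coeff_sub_toLp_le (ξ : (biregular μ).space) {ε : ℝ} (hε : 0 < ε) :
    ∃ f : C_c(G, ℂ), ∀ p,
      ‖(biregular μ).coeff ξ p - (biregular μ).coeff ((f.memLp_two μ).toLp f) p‖ ≤ ε := by
  change Lp ℂ 2 μ at ξ
  -- The bound δ ≤ 1 gives ‖ξ‖ + ‖g‖ ≤ 2‖ξ‖ + 1, the second factor in the coefficient estimate.
  set δ : ℝ := min 1 (ε / (2 * ‖ξ‖ + 1))
  have hδ : 0 < δ := lt_min one_pos (by positivity)
  obtain ⟨g, hfg, hg, hm, hc⟩ := exists_hasCompactSupport_eLpNorm_sub_le μ (Lp.memLp ξ)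
    (ε := ENNReal.ofReal δ) (by simpa using hδ)
  have hd : ‖ξ - hm.toLp g‖ ≤ δ := by
    have h1 : ξ - hm.toLp g = ((Lp.memLp ξ).sub hm).toLp _ := by
      rw [MemLp.toLp_sub (Lp.memLp ξ) hm, Lp.toLp_coeFn]
    rw [h1, Lp.norm_toLp]
    exact ENNReal.toReal_le_of_le_ofReal hδ.le hfg
  refine ⟨⟨⟨g, hg⟩, hc⟩, fun p => ((biregular μ).norm_coeff_sub_le _ _ p).trans ?_⟩
  change ‖ξ - hm.toLp g‖ * (‖ξ‖ + ‖hm.toLp g‖) ≤ ε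
  have h3 : ‖hm.toLp g‖ ≤ ‖ξ‖ + 1 := by
    have := norm_sub_norm_le (hm.toLp g) ξ
    rw [norm_sub_rev] at this
    linarith [min_le_left 1 (ε / (2 * ‖ξ‖ + 1))]
  calc ‖ξ - hm.toLp g‖ * (‖ξ‖ + ‖hm.toLp g‖)
      ≤ ε / (2 * ‖ξ‖ + 1) * (2 * ‖ξ‖ + 1) := by
        refine mul_le_mul (hd.trans (min_le_right _ _)) (by linarith) (by positivity) (by positivity)
    _ = ε := div_mul_cancel₀ _ (by positivity)

end Approximation

/-! ### Convergence of coefficients and Fell convergence -/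

section Convergence

variable {G : Type*} [Group G] [TopologicalSpace G] [IsTopologicalGroup G]
  [LocallyCompactSpace G] [T2Space G] [MeasurableSpace G] [BorelSpace G]
  (μ : Measure G) [μ.IsHaarMeasure] [μ.Regular]

/-- A coefficient of the representation on `L²(G ⧸ N)` at a function pushed forward from `G`, as an
integral over `G`. -/
theorem exists_quotientBiregular_coeff_eq (N : Subgroup G) [N.Normal] (hc : IsClosed (N : Set G))
    (ν : Measure N) [ν.IsHaarMeasure] (m : Measure (G ⧸ N)) [m.IsHaarMeasure] [m.Regular]
    (f : C_c(G, ℂ)) :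
    ∃ η : (quotientBiregular N m).space, ∀ s t : G,
      (quotientBiregular N m).coeff η (s, t) = √(modularFunction (t : G ⧸ N) : ℝ) *
        ∫ x, conj (f x) * (TopologicalGroup.IsSES.ofClosedSubgroup N hc).pushforward ν f
          ((s⁻¹ * x * t : G) : G ⧸ N) ∂μ := by
  have H := TopologicalGroup.IsSES.ofClosedSubgroup N hc
  obtain ⟨c, hc0, hw⟩ := H.exists_pos_integral_pushforward_eq ν m μ
  set F : C_c(G ⧸ N, ℂ) := H.pushforward ν f
  let ζ : (biregular m).space := (F.memLp_two m).toLp F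
  -- Coefficients are quadratic in the vector, so the factor c^{-1/2} cancels the constant c in
  -- Weil's formula.
  refine ⟨((√c)⁻¹ : ℝ) • ζ, fun s t => ?_⟩
  have h0 : (quotientBiregular N m).coeff (((√c)⁻¹ : ℝ) • ζ) (s, t)
      = (biregular m).coeff ((((√c)⁻¹ : ℝ) : ℂ) • ζ) ((s : G ⧸ N), (t : G ⧸ N)) := by
    rw [← Complex.coe_smul]; rfl
  rw [h0, UnitaryRep.coeff_ofReal_smul, biregular_coeff_toLp]
  -- By normality of N the factor F(s⁻¹xtN) depends only on xN, so averaging h over N affects only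
  -- conj f.
  let h : C_c(G, ℂ) := ⟨⟨fun x => conj (f x) * F ((s⁻¹ * x * t : G) : G ⧸ N), by fun_prop⟩,
    (f.hasCompactSupport.comp_left (g := conj) (map_zero _)).mul_right⟩
  have hpush (x : G ⧸ N) :
      H.pushforward ν h x = conj (F x) * F ((s : G ⧸ N)⁻¹ * x * (t : G ⧸ N)) := by
    obtain ⟨x, rfl⟩ := QuotientGroup.mk'_surjective N x
    rw [H.pushforward_apply_apply, H.pushforward_apply_apply, ← integral_conj,
      ← integral_mul_const]
    congr 1 with n
    change conj (f (x * n)) * F ((s⁻¹ * (x * n) * t : G) : G ⧸ N) = conj (f (x * n)) * _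
    congr 2
    simp
  have h1 := hw h
  simp_rw [hpush] at h1
  rw [h1, inv_pow, Real.sq_sqrt hc0.le]
  change _ = _ * ∫ x, h x ∂μ
  have : (c : ℂ) ≠ 0 := Complex.ofReal_ne_zero.2 hc0.ne'
  push_cast
  field_simp

theorem eventually_exists_coeff_toLp_sub_le {ι : Type*} {l : Filter ι} (N : ι → Subgroup G)
    [∀ i, (N i).Normal] (hclosed : ∀ i, IsClosed (N i : Set G))
    (hN : ∀ K : Set G, IsCompact K → ∀ U ∈ 𝓝 (1 : G), ∀ᶠ i in l, (N i : Set G) ∩ K ⊆ U)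
    (m : ∀ i, Measure (G ⧸ N i)) [∀ i, (m i).IsHaarMeasure] [∀ i, (m i).Regular]
    (f : C_c(G, ℂ)) {Q : Set (G × G)} (hQ : IsCompact Q) {ε : ℝ} (hε : 0 < ε) :
    ∀ᶠ i in l, ∃ η : (quotientBiregular (N i) (m i)).space, ∀ p ∈ Q,
      ‖(biregular μ).coeff ((f.memLp_two μ).toLp f) p
        - (quotientBiregular (N i) (m i)).coeff η p‖ ≤ ε := by
  set K := Prod.snd '' Q
  have hK : IsCompact K := hQ.image continuous_snd
  obtain ⟨M, hM⟩ := (hK.image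
    ((NNReal.continuous_coe.comp continuous_modularFunction).sqrt)).bddAbove
  -- The absolute value is needed because M may be negative when K is empty.
  have hM' {t : G} (ht : t ∈ K) : √(modularFunction t : ℝ) ≤ |M| :=
    (hM ⟨t, ht, rfl⟩).trans (le_abs_self M)
  let C : Set G := (fun p : (G × G) × G => p.1.1⁻¹ * p.2 * p.1.2) '' (Q ×ˢ tsupport f)
  have hC : IsCompact C := (hQ.prod f.hasCompactSupport).image (by fun_prop)
  -- C contains every point s⁻¹xt at which f and F are compared; D contains every n with f(yn) ≠ 0
  -- for some y in C.
  let D : Set G := (fun p : G × G => p.1⁻¹ * p.2) '' (C ×ˢ tsupport f)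
  have hD : IsCompact D := (hC.prod f.hasCompactSupport).image (by fun_prop)
  obtain ⟨V₀, hV₀, hV₀n⟩ := exists_compact_mem_nhds (1 : G)
  -- Adding V₀ makes V a neighbourhood of 1, so that N ∩ V has positive Haar measure in N.
  set V : Set G := D ∪ V₀
  have hV : IsCompact V := hD.union hV₀
  have hVn : V ∈ 𝓝 (1 : G) := mem_of_superset hV₀n Set.subset_union_right
  set I : ℝ := ∫ x, ‖f x‖ ∂μ
  have hI : 0 ≤ I := integral_nonneg fun _ => norm_nonneg _
  set δ : ℝ := ε / (|M| * I + 1)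
  have hδ : 0 < δ := by positivity
  -- The neighbourhood U of the hypothesis is the set of u that serve both comparisons: conjugates
  -- under K stay in V, and f(yu) is δ-close to f(y) on C.
  filter_upwards [hN V hV _
    ((eventually_conj_mem hK hVn).and (eventually_norm_mul_right_sub_le f.continuous hC hδ))]
    with i hi
  have hemb := (hclosed i).isClosedEmbedding_subtypeVal
  have : LocallyCompactSpace (N i) := hemb.locallyCompactSpace
  let X : TopologicalSpace.PositiveCompacts (N i) :=
    ⟨⟨Subtype.val ⁻¹' V, hemb.isCompact_preimage hV⟩,
      ⟨1, mem_interior_iff_mem_nhds.2 (continuous_subtype_val.continuousAt.preimage_mem_nhds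
        (by simpa using hVn))⟩⟩
  have hX : haarMeasure X (Subtype.val ⁻¹' V) = 1 := haarMeasure_self
  obtain ⟨η, hη⟩ := exists_quotientBiregular_coeff_eq μ (N i) (hclosed i) (haarMeasure X) (m i) f
  refine ⟨η, fun ⟨s, t⟩ hp => ?_⟩
  have ht : t ∈ K := ⟨(s, t), hp, rfl⟩
  rw [hη, biregular_coeff_toLp, modularFunction_mk_eq (N i) (hclosed i) (haarMeasure X) t
    (measurePreserving_conjNormalContinuous (N i) _ (by simp [hX]) (by simp [hX]) hi
      fun u hu => hu.1 t ht)]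
  set F := (TopologicalGroup.IsSES.ofClosedSubgroup (N i) (hclosed i)).pushforward (haarMeasure X) f
  have hcs : HasCompactSupport fun x => conj (f x) :=
    f.hasCompactSupport.comp_left (g := conj) (map_zero _)
  have int1 : Integrable (fun x => conj (f x) * f (s⁻¹ * x * t)) μ :=
    Continuous.integrable_of_hasCompactSupport (by fun_prop) hcs.mul_right
  have int2 : Integrable (fun x => conj (f x) * F ((s⁻¹ * x * t : G) : G ⧸ N i)) μ :=
    Continuous.integrable_of_hasCompactSupport (by fun_prop) hcs.mul_right
  rw [← mul_sub, ← integral_sub int1 int2, norm_mul]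
  have key (x : G) : ‖conj (f x) * f (s⁻¹ * x * t)
      - conj (f x) * F ((s⁻¹ * x * t : G) : G ⧸ N i)‖ ≤ ‖f x‖ * δ := by
    rw [← mul_sub, norm_mul, RCLike.norm_conj]
    by_cases hx : f x = 0
    · simp [hx]
    have hy : s⁻¹ * x * t ∈ C := ⟨((s, t), x), ⟨hp, subset_tsupport _ hx⟩, rfl⟩
    rw [norm_sub_rev]
    refine mul_le_mul_of_nonneg_left ?_ (norm_nonneg _)
    exact norm_pushforward_sub_le (N i) (hclosed i) (haarMeasure X) f hX _
      (fun n hn => Or.inl ⟨(s⁻¹ * x * t, s⁻¹ * x * t * n), ⟨hy, subset_tsupport _ hn⟩,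
        by dsimp only; group⟩)
      (fun n hn => (hi ⟨n.2, hn⟩).2 _ hy)
  have h3 := norm_integral_le_of_norm_le (f.integrable.norm.mul_const δ) (ae_of_all μ key)
  rw [integral_mul_const] at h3
  have h4 : ‖((√(modularFunction t : ℝ) : ℝ) : ℂ)‖ ≤ |M| := by
    rw [Complex.norm_real, Real.norm_of_nonneg (Real.sqrt_nonneg _)]
    exact hM' ht
  calc _ ≤ |M| * (I * δ) := mul_le_mul h4 h3 (norm_nonneg _) (abs_nonneg _)
    _ = ε * (|M| * I / (|M| * I + 1)) := by ring
    _ ≤ ε := mul_le_of_le_one_right hε.le ((div_le_one (by positivity)).2 (by linarith))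

theorem eventually_exists_coeff_sub_le {ι : Type*} {l : Filter ι} (N : ι → Subgroup G)
    [∀ i, (N i).Normal] (hclosed : ∀ i, IsClosed (N i : Set G))
    (hN : ∀ K : Set G, IsCompact K → ∀ U ∈ 𝓝 (1 : G), ∀ᶠ i in l, (N i : Set G) ∩ K ⊆ U)
    (m : ∀ i, Measure (G ⧸ N i)) [∀ i, (m i).IsHaarMeasure] [∀ i, (m i).Regular]
    (ξ : (biregular μ).space) {Q : Set (G × G)} (hQ : IsCompact Q) {ε : ℝ} (hε : 0 < ε) :
    ∀ᶠ i in l, ∃ η : (quotientBiregular (N i) (m i)).space, ∀ p ∈ Q,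
      ‖(biregular μ).coeff ξ p - (quotientBiregular (N i) (m i)).coeff η p‖ ≤ ε := by
  obtain ⟨f, hf⟩ := exists_norm_coeff_sub_toLp_le μ ξ (half_pos hε)
  filter_upwards [eventually_exists_coeff_toLp_sub_le μ N hclosed hN m f hQ (half_pos hε)]
    with i ⟨η, hη⟩
  exact ⟨η, fun p hp => (norm_sub_le_norm_sub_add_norm_sub _ _ _).trans
    ((add_le_add (hf p) (hη p hp)).trans_eq (add_halves ε))⟩

/-- To converge in the Fell topology it is enough to approximate, uniformly on compact sets, every
coefficient of the limit by coefficients of the net. -/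
theorem UnitaryRep.tendsto_of_eventually_coeff_sub_le {Γ : Type*} [Group Γ] [TopologicalSpace Γ]
    {ι : Type*} {l : Filter ι} {σ : ι → UnitaryRep Γ} {τ : UnitaryRep Γ}
    (h : ∀ ξ : τ.space, ∀ Q : Set Γ, IsCompact Q → ∀ ε : ℝ, 0 < ε → ∀ᶠ i in l,
      ∃ η : (σ i).space, ∀ s ∈ Q, ‖τ.coeff ξ s - (σ i).coeff η s‖ ≤ ε) :
    Tendsto σ l (𝓝 τ) := by
  refine TopologicalSpace.tendsto_nhds_generateFrom_iff.2 ?_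
  rintro _ ⟨π, ξ, Q, ε, hQ, hε, rfl⟩ ⟨k, η, hη⟩
  -- On compact Q the continuous error attains its maximum, which leaves a uniform gap below ε to be
  -- shared among the k coefficients of τ.
  obtain ⟨ε', hε', hle⟩ : ∃ ε' < ε, ∀ s ∈ Q, ‖π.coeff ξ s - ∑ j, τ.coeff (η j) s‖ ≤ ε' := by
    rcases Q.eq_empty_or_nonempty with rfl | hne
    · exact ⟨ε - 1, by linarith, by simp⟩
    · have hcont : Continuous fun s => ‖π.coeff ξ s - ∑ j, τ.coeff (η j) s‖ :=
        ((π.continuous_coeff ξ).sub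
          (continuous_finsetSum _ fun j _ => τ.continuous_coeff (η j))).norm
      obtain ⟨s, hs, hmax⟩ := hQ.exists_isMaxOn hne hcont.continuousOn
      exact ⟨_, hη s hs, fun s' hs' => hmax hs'⟩
  -- Dividing by k + 1 keeps the total error strictly below the gap and covers k = 0.
  have hδ : 0 < (ε - ε') / (k + 1) := div_pos (by linarith) (by positivity)
  filter_upwards [eventually_all.2 fun j => h (η j) Q hQ _ hδ] with i hi
  choose ζ hζ using hi
  refine ⟨k, ζ, fun s hs => ?_⟩
  have h1 : ‖∑ j, τ.coeff (η j) s - ∑ j, (σ i).coeff (ζ j) s‖ ≤ k * ((ε - ε') / (k + 1)) := by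
    rw [← Finset.sum_sub_distrib]
    refine (norm_sum_le_of_le _ fun j _ => hζ j s hs).trans_eq ?_
    simp
  have h2 : k * ((ε - ε') / (k + 1)) < ε - ε' := by
    rw [mul_div_assoc', div_lt_iff₀ (by positivity)]
    nlinarith
  exact (norm_sub_le_norm_sub_add_norm_sub _ _ _).trans_lt (by linarith [hle s hs])

end Convergence

theorem mainTheorem5 {G : Type*} [Group G] [TopologicalSpace G] [IsTopologicalGroup G]
    [LocallyCompactSpace G] [T2Space G] [MeasurableSpace G] [BorelSpace G]
    (μ : Measure G) [μ.IsHaarMeasure] [μ.Regular]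
    {ι : Type*} [Preorder ι] [IsDirectedOrder ι] [Nonempty ι]
    (N : ι → Subgroup G) [∀ i, (N i).Normal] (hclosed : ∀ i, IsClosed (N i : Set G))
    (hN : ∀ K : Set G, IsCompact K → ∀ U ∈ 𝓝 (1 : G),
      ∃ i₀, ∀ i, i₀ ≤ i → (N i : Set G) ∩ K ⊆ U)
    (m : ∀ i, Measure (G ⧸ N i)) [∀ i, (m i).IsHaarMeasure] [∀ i, (m i).Regular] :
    Tendsto (fun i => quotientBiregular (N i) (m i)) atTop (𝓝 (biregular μ)) := by
  exact UnitaryRep.tendsto_of_eventually_coeff_sub_le fun ξ _ hQ _ hε =>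
    eventually_exists_coeff_sub_le μ N hclosed
      (fun K hK U hU => let ⟨i₀, h⟩ := hN K hK U hU; eventually_atTop.2 ⟨i₀, h⟩) m ξ hQ hε
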